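/- Let $Q_0=[0,1]^2$ and let $\mathcal D$ be the family of all dyadic rectangles $R=\left[\frac{j}{2^m},\frac{j+1}{2^m}\right]\times\left[\frac{k}{2^n},\frac{k+1}{2^n}\right]$ with integers $m,n\ge 0$, $0\le j<2^m$, $0\le k<2^n$. Let $\mu$ be a finite positive Borel measure on $Q_0$ that is atom free, i.e. $\mu(\{x\})=0$ for every $x\in Q_0$. A weight $\alpha=\{\alpha_Q\}_{Q\in\mathcal D}$ with $\alpha_Q\in[0,\infty)$ satisfies the Carleson condition if there is $C<\infty$ such that for every subfamily $\mathcal S\subset\mathcal D$ $$\sum_{Q\in\mathcal S}\alpha_Q\,\mu(Q)^2\le C\,\mu\Big(\bigcup_{Q\in\mathcal S}Q\Big).$$ The embedding holds for $\alpha$ if there is $C'<\infty$ such that for every real-valued $\psi\in L^2(\mu)$ $$\sum_{R\in\mathcal D}\Big(\int_R\psi\,d\mu\Big)^2\alpha_R\le C'\int_{Q_0}\psi^2\,d\mu .$$ The measure $\mu$ is called bad if there is a weight $\alpha$ that satisfies the Carleson condition and for which the embedding does not hold. The strong dyadic maximal function is $$\mathcal M_\mu\psi(x)=\sup_{R\in\mathcal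 D,\ R\ni x}\frac1{\mu(R)}\int_R|\psi|\,d\mu,\qquad 0/0:=0,$$ and $\mathcal M_\mu$ is bounded on $L^2(\mu)$ if there is $C''<\infty$ with $\|\mathcal M_\mu\psi\|_{L^2(\mu)}\le C''\|\psi\|_{L^2(\mu)}$ for all $\psi\in L^2(\mu)$. Then $\mu$ is bad if and only if $\mathcal M_\mu$ is not bounded on $L^2(\mu)$. -/

import Mathlib

open MeasureTheory Set
open scoped ENNReal NNReal

namespace BiParam

/-- The unit square `Q₀ = [0,1]²`, with its Borel σ-algebra. -/
abbrev UnitSquare : Type := unitInterval × unitInterval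

/-- Indices of the dyadic subintervals of `[0,1]`: the pair `(n, j)` with `0 ≤ j < 2 ^ n`
stands for the interval `[j / 2 ^ n, (j + 1) / 2 ^ n]`. -/
abbrev DyadicInterval : Type := Σ n : ℕ, Fin (2 ^ n)

/-- The closed dyadic interval `[j / 2 ^ n, (j + 1) / 2 ^ n]` of the real line. -/
def DyadicInterval.toSet (I : DyadicInterval) : Set ℝ :=
  Icc (((I.2 : ℕ) : ℝ) / 2 ^ I.1) ((((I.2 : ℕ) : ℝ) + 1) / 2 ^ I.1)

/-- The family `𝒟` of all dyadic subrectangles of `Q₀` (products of two dyadic intervals whose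
lengths are independent of each other). Different indices give different rectangles. -/
abbrev DyadicRect : Type := DyadicInterval × DyadicInterval

/-- The dyadic rectangle as a subset of the unit square. -/
def DyadicRect.toSet (R : DyadicRect) : Set UnitSquare :=
  {x | (x.1 : ℝ) ∈ DyadicInterval.toSet R.1 ∧ (x.2 : ℝ) ∈ DyadicInterval.toSet R.2}

/-- The weight `α` satisfies the Carleson condition with respect to `μ`: for some finite `C` and
every subfamily `S` of dyadic rectangles,
`∑_{Q ∈ S} α_Q μ(Q)² ≤ C μ(⋃_{Q ∈ S} Q)`. -/
def CarlesonCondition (μ : Measure UnitSquare) (α : DyadicRect → ℝ≥0) : Prop :=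
  ∃ C : ℝ≥0, ∀ S : Set DyadicRect,
    ∑' Q : S, (α Q : ℝ≥0∞) * μ (DyadicRect.toSet (Q : DyadicRect)) ^ 2
      ≤ C * μ (⋃ Q ∈ S, DyadicRect.toSet Q)

/-- The two-weight bi-parameter embedding: for some finite `C` and every `ψ ∈ L²(μ)`,
`∑_R (∫_R ψ dμ)² α_R ≤ C ∫ ψ² dμ`. -/
def EmbeddingHolds (μ : Measure UnitSquare) (α : DyadicRect → ℝ≥0) : Prop :=
  ∃ C : ℝ≥0, ∀ ψ : UnitSquare → ℝ, MemLp ψ 2 μ →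
    ∑' R : DyadicRect,
        ENNReal.ofReal ((∫ x in DyadicRect.toSet R, ψ x ∂μ) ^ 2) * (α R : ℝ≥0∞)
      ≤ C * ∫⁻ x, ENNReal.ofReal (ψ x ^ 2) ∂μ

/-- `μ` is bad if some weight satisfies the Carleson condition although the embedding fails. -/
def IsBad (μ : Measure UnitSquare) : Prop :=
  ∃ α : DyadicRect → ℝ≥0, CarlesonCondition μ α ∧ ¬ EmbeddingHolds μ α

/-- The strong dyadic maximal function
`M_μ ψ (x) = sup_{R ∋ x} μ(R)⁻¹ ∫_R |ψ| dμ`. The convention `0 / 0 = 0` for null rectangles is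
the one of division in `ℝ≥0∞`. -/
noncomputable def strongMaximal (μ : Measure UnitSquare) (ψ : UnitSquare → ℝ)
    (x : UnitSquare) : ℝ≥0∞ :=
  ⨆ (R : DyadicRect) (_ : x ∈ DyadicRect.toSet R),
    (∫⁻ y in DyadicRect.toSet R, ‖ψ y‖ₑ ∂μ) / μ (DyadicRect.toSet R)

/-- `M_μ` is bounded on `L²(μ)`: `‖M_μ ψ‖₂ ≤ C ‖ψ‖₂` for some finite `C` and all `ψ ∈ L²(μ)`. -/
def StrongMaximalBoundedL2 (μ : Measure UnitSquare) : Prop :=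
  ∃ C : ℝ≥0, ∀ ψ : UnitSquare → ℝ, MemLp ψ 2 μ →
    eLpNorm (strongMaximal μ ψ) 2 μ ≤ C * eLpNorm ψ 2 μ

end BiParam

/-!
Write `w R = α R * μ(R)²` and let `a R` be the `μ`-average of `|ψ|` over `R`, so that the embedding
sum of `|ψ|` is `∑ w R * a R ^ 2`.

If `M_μ` is bounded, regard `w` as a measure on the countable set of rectangles. The layer cake
formula turns the embedding sum into `∫ 2t w {a > t} dt`. The rectangles with `a R > t` all lie in
`{M_μ ψ > t}`, so the Carleson condition bounds `w {a > t}` by `C μ {M_μ ψ > t}`, and the sum is at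
most `C ‖M_μ ψ‖₂²` (`tsum_mul_sq_le_of_carleson`).

If `M_μ` is unbounded, then for each `n` some finite family of rectangles and some `ψₙ` give a
truncated maximal function with `∫ (M ψₙ)² > 4ⁿ ∫ ψₙ²`. Assigning each point to one rectangle at
which the maximum is attained yields disjoint sets `E R ⊆ R`
(`exists_disjoint_lintegral_iSup_indicator_le`). The weight `βₙ R = μ (E R) / μ(R)²` satisfies the
Carleson condition with constant `1` because the `E R` are disjoint, while its embedding sum at
`ψₙ` is at least the squared norm of the truncated maximal function. The weight `∑ 2⁻ⁿ βₙ` is then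
Carleson, and its embedding constant would have to exceed every `2ⁿ`.
-/

/-! ### Abstract families of sets -/

/-- The Carleson embedding theorem with the maximal function as right-hand side: `w` is a Carleson
sequence for the sets `A i`, and `M` dominates the value `a i` on `A i`. -/
theorem tsum_mul_sq_le_of_carleson {X ι : Type*} [MeasurableSpace X] {μ : Measure X}
    {A : ι → Set X} {w : ι → ℝ≥0∞} {C : ℝ≥0∞}
    (hw : ∀ S : Set ι, ∑' i : S, w i ≤ C * μ (⋃ i ∈ S, A i))
    {a : ι → ℝ≥0∞} (ha : ∀ i, a i ≠ ∞) {M : X → ℝ≥0∞} (hM : Measurable M)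
    (hMtop : ∫⁻ x, M x ^ 2 ∂μ ≠ ∞) (haM : ∀ i, ∀ x ∈ A i, a i ≤ M x) :
    ∑' i, w i * a i ^ 2 ≤ C * ∫⁻ x, M x ^ 2 ∂μ := by
  let _ : MeasurableSpace ι := ⊤
  let ν : Measure ι := Measure.sum fun i => w i • Measure.dirac i
  have hν : ∀ S : Set ι, ν S = ∑' i : S, w i := fun S => by
    rw [tsum_subtype S w, Measure.sum_apply _ (MeasurableSpace.measurableSet_top)]
    refine tsum_congr fun i => ?_
    by_cases hi : i ∈ S <;> simp [hi]
  have hfin : ∀ᵐ x ∂μ, M x ≠ ∞ := by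
    filter_upwards [ae_lt_top (hM.pow_const 2) hMtop] with x hx h
    simp [h] at hx
  have hL : ∑' i, w i * a i ^ 2 = ∫⁻ i, ENNReal.ofReal ((a i).toReal ^ (2 : ℝ)) ∂ν := by
    rw [lintegral_sum_measure]
    refine tsum_congr fun i => ?_
    rw [lintegral_smul_measure, lintegral_dirac, Real.rpow_two,
      ENNReal.ofReal_pow ENNReal.toReal_nonneg, ENNReal.ofReal_toReal (ha i), smul_eq_mul]
  have hR : ∫⁻ x, M x ^ 2 ∂μ = ∫⁻ x, ENNReal.ofReal ((M x).toReal ^ (2 : ℝ)) ∂μ := by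
    refine lintegral_congr_ae ?_
    filter_upwards [hfin] with x hx
    rw [Real.rpow_two, ENNReal.ofReal_pow ENNReal.toReal_nonneg, ENNReal.ofReal_toReal hx]
  rw [hL, hR, lintegral_rpow_eq_lintegral_meas_lt_mul ν
      (Filter.Eventually.of_forall fun _ => ENNReal.toReal_nonneg)
      measurable_from_top.aemeasurable two_pos,
    lintegral_rpow_eq_lintegral_meas_lt_mul μ
      (Filter.Eventually.of_forall fun _ => ENNReal.toReal_nonneg)
      hM.ennreal_toReal.aemeasurable two_pos, mul_left_comm]
  gcongr
  have hanti : Antitone fun t : ℝ => μ {x | t < (M x).toReal} := fun s t hst =>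
    measure_mono fun x (hx : t < (M x).toReal) => hst.trans_lt hx
  have hmeas : Measurable fun t : ℝ =>
      μ {x | t < (M x).toReal} * ENNReal.ofReal (t ^ ((2 : ℝ) - 1)) :=
    hanti.measurable.mul (by fun_prop)
  rw [← lintegral_const_mul _ hmeas]
  refine lintegral_mono fun t => ?_
  rw [← mul_assoc]
  gcongr
  rw [hν]
  refine (hw _).trans ?_
  gcongr C * ?_
  refine measure_mono_ae ?_
  filter_upwards [hfin] with x hx hmem
  obtain ⟨i, hi, hxi⟩ := mem_iUnion₂.1 hmem
  exact lt_of_lt_of_le hi (ENNReal.toReal_mono hx (haM i x hxi))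

/-- Linearisation of a finite maximal function: each point of `⋃ i ∈ F, A i` is assigned to one
index at which the maximum is attained. -/
theorem exists_disjoint_lintegral_iSup_indicator_le {X ι : Type*} [MeasurableSpace X]
    [Countable ι] (μ : Measure X) {A : ι → Set X} (hA : ∀ i, MeasurableSet (A i))
    (c : ι → ℝ≥0∞) (F : Finset ι) :
    ∃ E : ι → Set X, (∀ i, MeasurableSet (E i)) ∧ Pairwise (Function.onFun Disjoint E) ∧
      (∀ i, E i ⊆ A i) ∧
      ∫⁻ x, ⨆ i ∈ F, (A i).indicator (fun _ => c i) x ∂μ ≤ ∑' i, c i * μ (E i) := by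
  classical
  obtain ⟨e, he⟩ := Countable.exists_injective_nat ι
  -- The second component breaks ties, so that the maximising index is unique.
  let key : ι → ℝ≥0∞ ×ₗ ℕ := fun i => toLex (c i, e i)
  have hkey : Function.Injective key := fun i j h =>
    he (congrArg Prod.snd (toLex.injective h))
  let E : ι → Set X := fun i => {x | i ∈ F ∧ x ∈ A i ∧ ∀ j ∈ F, x ∈ A j → key j ≤ key i}
  have hE : ∀ i, MeasurableSet (E i) := fun i => by
    refine (MeasurableSet.const _).inter ((hA i).inter ?_)
    have : {x | ∀ j ∈ F, x ∈ A j → key j ≤ key i} = ⋂ j ∈ F, {x | x ∈ A j → key j ≤ key i} := by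
      ext; simp
    change MeasurableSet {x | ∀ j ∈ F, x ∈ A j → key j ≤ key i}
    rw [this]
    exact F.measurableSet_biInter fun j _ => (hA j).imp (MeasurableSet.const _)
  refine ⟨E, hE, fun i j hij => ?_, fun i x hx => hx.2.1, ?_⟩
  · refine disjoint_left.2 fun x hi hj => hij (hkey (le_antisymm ?_ ?_))
    · exact hj.2.2 i hi.1 hi.2.1
    · exact hi.2.2 j hj.1 hj.2.1
  · calc ∫⁻ x, ⨆ i ∈ F, (A i).indicator (fun _ => c i) x ∂μ
        ≤ ∫⁻ x, ∑' i, (E i).indicator (fun _ => c i) x ∂μ := by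
          refine lintegral_mono fun x => iSup₂_le fun i hi => ?_
          by_cases hx : x ∈ A i
          swap
          · simp [hx]
          rw [indicator_of_mem hx]
          obtain ⟨j, hj, hmax⟩ := (F.filter fun j => x ∈ A j).exists_max_image key
            ⟨i, Finset.mem_filter.2 ⟨hi, hx⟩⟩
          obtain ⟨hjF, hxj⟩ := Finset.mem_filter.1 hj
          have hxE : x ∈ E j := ⟨hjF, hxj, fun k hk hxk => hmax k (Finset.mem_filter.2 ⟨hk, hxk⟩)⟩
          have hle : c i ≤ c j := Prod.Lex.monotone_fst _ _ (hmax i (Finset.mem_filter.2 ⟨hi, hx⟩))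
          refine hle.trans (le_trans ?_ (ENNReal.le_tsum j))
          simp [hxE]
      _ = ∑' i, c i * μ (E i) := by
          rw [lintegral_tsum fun i => (measurable_const.indicator (hE i)).aemeasurable]
          exact tsum_congr fun i => lintegral_indicator_const (hE i) _

theorem exists_finset_lt_lintegral_iSup {X ι : Type*} [MeasurableSpace X] [Countable ι]
    {μ : Measure X} {f : ι → X → ℝ≥0∞} (hf : ∀ i, Measurable (f i)) {K : ℝ≥0∞}
    (hK : K < ∫⁻ x, ⨆ i, f i x ∂μ) : ∃ F : Finset ι, K < ∫⁻ x, ⨆ i ∈ F, f i x ∂μ := by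
  have hsup : ∫⁻ x, ⨆ i, f i x ∂μ = ⨆ F : Finset ι, ∫⁻ x, ⨆ i ∈ F, f i x ∂μ := by
    simp_rw [iSup_eq_iSup_finset fun i => f i _]
    refine lintegral_iSup_directed (fun F => ?_) (Monotone.directed_le fun F G h x => ?_)
    · exact (Measurable.biSup _ F.countable_toSet fun i _ => hf i).aemeasurable
    · exact biSup_mono fun i hi => h hi
  exact lt_iSup_iff.1 (hsup ▸ hK)

namespace BiParam

/-! ### The strong maximal function -/

theorem measurableSet_toSet (R : DyadicRect) : MeasurableSet R.toSet := by
  refine MeasurableSet.inter ?_ ?_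
  · exact (measurable_subtype_coe.comp measurable_fst) measurableSet_Icc
  · exact (measurable_subtype_coe.comp measurable_snd) measurableSet_Icc

theorem strongMaximal_eq_iSup_indicator (μ : Measure UnitSquare) (ψ : UnitSquare → ℝ)
    (x : UnitSquare) :
    strongMaximal μ ψ x = ⨆ R : DyadicRect,
      R.toSet.indicator (fun _ => (∫⁻ y in R.toSet, ‖ψ y‖ₑ ∂μ) / μ R.toSet) x := by
  refine iSup_congr fun R => ?_
  by_cases hx : x ∈ R.toSet <;> simp [hx]

theorem measurable_strongMaximal (μ : Measure UnitSquare) (ψ : UnitSquare → ℝ) :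
    Measurable (strongMaximal μ ψ) := by
  rw [funext (strongMaximal_eq_iSup_indicator μ ψ)]
  exact Measurable.iSup fun R => measurable_const.indicator (measurableSet_toSet R)

theorem strongMaximal_sq (μ : Measure UnitSquare) (ψ : UnitSquare → ℝ) (x : UnitSquare) :
    strongMaximal μ ψ x ^ 2 = ⨆ R : DyadicRect,
      R.toSet.indicator (fun _ => ((∫⁻ y in R.toSet, ‖ψ y‖ₑ ∂μ) / μ R.toSet) ^ 2) x := by
  rw [strongMaximal_eq_iSup_indicator, ENNReal.iSup_pow_of_ne_zero two_ne_zero]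
  refine iSup_congr fun R => ?_
  by_cases hx : x ∈ R.toSet <;> simp [hx]

theorem eLpNorm_two_sq {X ε : Type*} [MeasurableSpace X] [ENorm ε] (μ : Measure X) (f : X → ε) :
    eLpNorm f 2 μ ^ 2 = ∫⁻ x, ‖f x‖ₑ ^ 2 ∂μ := by
  simpa using eLpNorm_nnreal_pow_eq_lintegral (μ := μ) (f := f) (p := 2) two_ne_zero

theorem strongMaximalBoundedL2_iff (μ : Measure UnitSquare) :
    StrongMaximalBoundedL2 μ ↔ ∃ C : ℝ≥0, ∀ ψ : UnitSquare → ℝ, MemLp ψ 2 μ →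
      ∫⁻ x, strongMaximal μ ψ x ^ 2 ∂μ ≤ C * ∫⁻ x, ‖ψ x‖ₑ ^ 2 ∂μ := by
  have key : ∀ (C : ℝ≥0) (ψ : UnitSquare → ℝ),
      eLpNorm (strongMaximal μ ψ) 2 μ ≤ C * eLpNorm ψ 2 μ ↔
      ∫⁻ x, strongMaximal μ ψ x ^ 2 ∂μ ≤ (C ^ 2 : ℝ≥0) * ∫⁻ x, ‖ψ x‖ₑ ^ 2 ∂μ := fun C ψ => by
    rw [← ENNReal.pow_le_pow_left_iff two_ne_zero, mul_pow, eLpNorm_two_sq, eLpNorm_two_sq,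
      ENNReal.coe_pow]
    simp only [enorm_eq_self]
  constructor
  · rintro ⟨C, hC⟩
    exact ⟨C ^ 2, fun ψ hψ => (key C ψ).1 (hC ψ hψ)⟩
  · rintro ⟨C, hC⟩
    refine ⟨NNReal.sqrt C, fun ψ hψ => (key _ ψ).2 ?_⟩
    rw [NNReal.sq_sqrt]
    exact hC ψ hψ

theorem lintegral_ofReal_sq (μ : Measure UnitSquare) (ψ : UnitSquare → ℝ) :
    ∫⁻ x, ENNReal.ofReal (ψ x ^ 2) ∂μ = ∫⁻ x, ‖ψ x‖ₑ ^ 2 ∂μ := by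
  refine lintegral_congr fun x => ?_
  rw [← sq_abs, ENNReal.ofReal_pow (abs_nonneg _), ← Real.enorm_eq_ofReal_abs]

/-! ### Boundedness of the maximal function implies the embedding -/

theorem embeddingHolds_of_strongMaximalBoundedL2 {μ : Measure UnitSquare} [IsFiniteMeasure μ]
    (hM : StrongMaximalBoundedL2 μ) {α : DyadicRect → ℝ≥0} (hα : CarlesonCondition μ α) :
    EmbeddingHolds μ α := by
  obtain ⟨K, hK⟩ := (strongMaximalBoundedL2_iff μ).1 hM
  obtain ⟨C, hC⟩ := hα
  refine ⟨C * K, fun ψ hψ => ?_⟩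
  have hψint : Integrable ψ μ := hψ.integrable one_le_two
  have hψ2 : ∫⁻ x, ‖ψ x‖ₑ ^ 2 ∂μ ≠ ∞ := by
    rw [← eLpNorm_two_sq]
    exact ENNReal.pow_ne_top hψ.eLpNorm_ne_top
  have hI : ∀ R : DyadicRect, ∫⁻ y in R.toSet, ‖ψ y‖ₑ ∂μ ≠ ∞ := fun R =>
    hψint.integrableOn.hasFiniteIntegral.ne
  rw [lintegral_ofReal_sq]
  calc ∑' R : DyadicRect, ENNReal.ofReal ((∫ x in R.toSet, ψ x ∂μ) ^ 2) * (α R : ℝ≥0∞)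
      ≤ ∑' R : DyadicRect, (α R : ℝ≥0∞) * μ R.toSet ^ 2 *
          ((∫⁻ y in R.toSet, ‖ψ y‖ₑ ∂μ) / μ R.toSet) ^ 2 := by
        refine ENNReal.tsum_le_tsum fun R => ?_
        rw [mul_assoc, ← mul_pow, mul_comm]
        gcongr
        rw [← sq_abs, ENNReal.ofReal_pow (abs_nonneg _), ← Real.enorm_eq_ofReal_abs]
        gcongr
        rw [ENNReal.mul_div_cancel' (fun h => setLIntegral_measure_zero _ _ h)
          fun h => absurd h (measure_ne_top _ _)]
        exact enorm_integral_le_lintegral_enorm _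
    _ ≤ C * ∫⁻ x, strongMaximal μ ψ x ^ 2 ∂μ := by
        refine tsum_mul_sq_le_of_carleson hC (fun R => ?_) (measurable_strongMaximal μ ψ)
          ((hK ψ hψ).trans_lt (ENNReal.mul_lt_top ENNReal.coe_lt_top hψ2.lt_top)).ne
          fun R x hx => le_iSup₂ (α := ℝ≥0∞) R hx
        -- On a null rectangle the average is `0 / 0 = 0`.
        by_cases h : μ R.toSet = 0
        · simp [setLIntegral_measure_zero _ _ h]
        · exact ENNReal.div_ne_top (hI R) h
    _ ≤ C * (K * ∫⁻ x, ‖ψ x‖ₑ ^ 2 ∂μ) := by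
        gcongr
        exact hK ψ hψ
    _ = (C * K : ℝ≥0) * ∫⁻ x, ‖ψ x‖ₑ ^ 2 ∂μ := by rw [ENNReal.coe_mul, mul_assoc]

/-! ### Unboundedness of the maximal function produces a bad weight -/

/-- A weight with Carleson constant `1` whose embedding sum at `|ψ|` exceeds a given number below
`‖M_μ ψ‖₂²`. The bound on `β` makes superpositions of such weights finite. -/
theorem exists_carleson_weight {μ : Measure UnitSquare} [IsFiniteMeasure μ] {ψ : UnitSquare → ℝ}
    {K : ℝ≥0∞} (hK : K < ∫⁻ x, strongMaximal μ ψ x ^ 2 ∂μ) :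
    ∃ β : DyadicRect → ℝ≥0∞, (∀ R, β R ≤ μ R.toSet / μ R.toSet ^ 2) ∧
      (∀ S : Set DyadicRect,
        ∑' Q : S, β Q * μ (DyadicRect.toSet Q) ^ 2 ≤ μ (⋃ Q ∈ S, DyadicRect.toSet Q)) ∧
      K < ∑' R : DyadicRect, (∫⁻ y in R.toSet, ‖ψ y‖ₑ ∂μ) ^ 2 * β R := by
  simp_rw [strongMaximal_sq] at hK
  obtain ⟨F, hF⟩ := exists_finset_lt_lintegral_iSup
    (fun R => measurable_const.indicator (measurableSet_toSet R)) hK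
  obtain ⟨E, hEm, hEd, hEs, hE⟩ := exists_disjoint_lintegral_iSup_indicator_le μ
    measurableSet_toSet (fun R => ((∫⁻ y in R.toSet, ‖ψ y‖ₑ ∂μ) / μ R.toSet) ^ 2) F
  refine ⟨fun R => μ (E R) / μ R.toSet ^ 2, fun R => ?_, fun S => ?_, ?_⟩
  · exact ENNReal.div_le_div_right (measure_mono (hEs R)) _
  · calc ∑' Q : S, μ (E Q) / μ (DyadicRect.toSet Q) ^ 2 * μ (DyadicRect.toSet Q) ^ 2
        ≤ ∑' Q : S, μ (E Q) := ENNReal.tsum_le_tsum fun Q => ENNReal.mul_le_of_le_div le_rfl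
      _ = μ (⋃ Q ∈ S, E Q) :=
          (measure_biUnion S.to_countable (hEd.set_pairwise S) fun Q _ => hEm Q).symm
      _ ≤ μ (⋃ Q ∈ S, DyadicRect.toSet Q) := measure_mono (iUnion₂_mono fun Q _ => hEs Q)
  · refine (hF.trans_le hE).trans_eq (tsum_congr fun R => ?_)
    simp only [div_eq_mul_inv, mul_pow, ENNReal.inv_pow]
    ring

theorem isBad_of_not_strongMaximalBoundedL2 {μ : Measure UnitSquare} [IsFiniteMeasure μ]
    (hM : ¬ StrongMaximalBoundedL2 μ) : IsBad μ := by
  have h : ∀ n : ℕ, ∃ ψ : UnitSquare → ℝ, MemLp ψ 2 μ ∧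
      (2 ^ n * 2 ^ n) * ∫⁻ x, ‖ψ x‖ₑ ^ 2 ∂μ < ∫⁻ x, strongMaximal μ ψ x ^ 2 ∂μ := fun n => by
    rw [strongMaximalBoundedL2_iff] at hM
    push Not at hM
    simpa using hM (2 ^ n * 2 ^ n)
  choose ψ hψ hψM using h
  choose β hβle hβC hβ using fun n => exists_carleson_weight (hψM n)
  have hsum : ∑' n : ℕ, (2⁻¹ : ℝ≥0∞) ^ n = 2 := ENNReal.tsum_geometric_two
  have htop : ∀ R, ∑' n, (2⁻¹ : ℝ≥0∞) ^ n * β n R ≠ ∞ := fun R => by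
    have hle : ∑' n, (2⁻¹ : ℝ≥0∞) ^ n * β n R ≤ 2 * (μ R.toSet / μ R.toSet ^ 2) := by
      refine le_of_le_of_eq ?_ ((ENNReal.tsum_mul_right (f := fun n => (2⁻¹ : ℝ≥0∞) ^ n)).trans
        (by rw [hsum]))
      exact ENNReal.tsum_le_tsum fun n => by gcongr; exact hβle n R
    refine ne_top_of_le_ne_top (ENNReal.mul_ne_top ENNReal.ofNat_ne_top ?_) hle
    by_cases h0 : μ R.toSet = 0
    · simp [h0]
    · exact ENNReal.div_ne_top (measure_ne_top _ _) (pow_ne_zero 2 h0)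
  have hα : ∀ R, ((∑' n, (2⁻¹ : ℝ≥0∞) ^ n * β n R).toNNReal : ℝ≥0∞) =
      ∑' n, (2⁻¹ : ℝ≥0∞) ^ n * β n R := fun R => ENNReal.coe_toNNReal (htop R)
  refine ⟨fun R => (∑' n, (2⁻¹ : ℝ≥0∞) ^ n * β n R).toNNReal, ⟨2, fun S => ?_⟩, ?_⟩
  · simp_rw [hα, ← ENNReal.tsum_mul_right]
    rw [ENNReal.tsum_comm, ENNReal.coe_ofNat]
    refine le_of_le_of_eq ?_ ((ENNReal.tsum_mul_right (f := fun n => (2⁻¹ : ℝ≥0∞) ^ n)).trans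
      (by rw [hsum]))
    refine ENNReal.tsum_le_tsum fun n => ?_
    simp_rw [mul_assoc]
    rw [ENNReal.tsum_mul_left]
    gcongr
    exact hβC n S
  · rintro ⟨C, hC⟩
    obtain ⟨n, hn⟩ := pow_unbounded_of_one_lt C (one_lt_two : (1 : ℝ≥0) < 2)
    have hψint : Integrable (ψ n) μ := (hψ n).integrable one_le_two
    have hn' : (C : ℝ≥0∞) ≤ 2 ^ n := by exact_mod_cast hn.le
    have hCn := hC (fun x => ‖ψ n x‖) (hψ n).norm
    rw [lintegral_ofReal_sq] at hCn
    simp_rw [enorm_norm] at hCn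
    refine (hβ n).not_ge ?_
    calc ∑' R : DyadicRect, (∫⁻ y in R.toSet, ‖ψ n y‖ₑ ∂μ) ^ 2 * β n R
        ≤ ∑' R : DyadicRect, 2 ^ n * (ENNReal.ofReal ((∫ x in R.toSet, ‖ψ n x‖ ∂μ) ^ 2) *
            ((∑' n, (2⁻¹ : ℝ≥0∞) ^ n * β n R).toNNReal : ℝ≥0∞)) := by
          refine ENNReal.tsum_le_tsum fun R => ?_
          rw [ENNReal.ofReal_pow (integral_nonneg fun _ => norm_nonneg _),
            ofReal_integral_norm_eq_lintegral_enorm hψint.integrableOn, hα, mul_left_comm]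
          gcongr
          calc β n R = 2 ^ n * ((2⁻¹ : ℝ≥0∞) ^ n * β n R) := by
                rw [← mul_assoc, ← mul_pow, ENNReal.mul_inv_cancel two_ne_zero
                  ENNReal.ofNat_ne_top, one_pow, one_mul]
            _ ≤ _ := by
                gcongr
                exact ENNReal.le_tsum n
      _ ≤ 2 ^ n * (2 ^ n * ∫⁻ x, ‖ψ n x‖ₑ ^ 2 ∂μ) := by
          rw [ENNReal.tsum_mul_left]
          gcongr
          refine hCn.trans ?_
          gcongr
      _ = 2 ^ n * 2 ^ n * ∫⁻ x, ‖ψ n x‖ₑ ^ 2 ∂μ := (mul_assoc _ _ _).symm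

end BiParam

theorem theorem4p1 (μ : Measure BiParam.UnitSquare) [IsFiniteMeasure μ] [NullSingletonClass μ] :
    BiParam.IsBad μ ↔ ¬ BiParam.StrongMaximalBoundedL2 μ := by
  refine ⟨?_, BiParam.isBad_of_not_strongMaximalBoundedL2⟩
  rintro ⟨α, hα, hemb⟩ hM
  exact hemb (BiParam.embeddingHolds_of_strongMaximalBoundedL2 hM hα)
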